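/- Let $\mathbb K$ be an algebraically closed field of characteristic zero, and let $\mathcal Z\subset\mathbb K^3$ be an irreducible affine surface (the zero set of an irreducible polynomial in three variables) that is not a plane parallel to one of the coordinate planes, i.e. not of the form $\{x=e\}$, $\{y=e\}$ or $\{z=e\}$ with $e\in\mathbb K$. Let $$\mathcal Q(t,s)=\left(\frac{N_1(t,s)}{D_1(t,s)},\frac{N_2(t,s)}{D_2(t,s)},\frac{N_3(t,s)}{D_3(t,s)}\right),\qquad N_i,D_i\in\mathbb K[t,s],\ D_i\neq 0,\ \gcd(N_i,D_i)=1,$$ be a (not necessarily proper) rational parametrization of $\mathcal Z$, that is, the set of its values at the points of $\mathbb K^2$ where $D_1D_2D_3\ne 0$ is a Zariski dense subset of $\mathcal Z$. For $A=(a,b,c)\in\mathbb K^3$ put $$\chi_1^A=\frac{N_2-bD_2}{N_1-aD_1}\cdot\frac{D_1}{D_2},\qquad \chi_2^A=\frac{N_3-cD_3}{N_1-aD_1}\cdot\frac{D_1}{D_3}\qquad\text{in }\mathbb K(t,s).$$ For $i=1,2$ let $g_i^{\mathcal Q,A}\in\mathbb K[h_1,h_2][t,s]$ be the numerator, in reduced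 form, of $\chi_i^A(t,s)-\chi_i^A(h_1,h_2)$, where $h_1,h_2$ are new variables, and let $k=\gcd(g_1^{\mathcal Q,A},g_2^{\mathcal Q,A})$, computed in $\mathbb K[h_1,h_2][t,s]$ (it is determined up to a nonzero constant). Put $g^{\mathcal Q,A}=k$ if $k$ has positive degree in $\{t,s\}$, and $g^{\mathcal Q,A}=1$ otherwise. Then $\mathcal Z$ is a plane if and only if there is a non-empty (Zariski) dense subset $\Omega$ of $\mathcal Z$ such that $g^{\mathcal Q,A}\neq 1$ for every $A\in\Omega$. -/

import Mathlib

noncomputable section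

namespace RationalSurface

variable {K : Type*} [Field K]

/-- The Zariski closure of a subset of affine space `σ → K`. -/
def zariskiClosure {σ : Type*} (S : Set (σ → K)) : Set (σ → K) :=
  MvPolynomial.zeroLocus K (MvPolynomial.vanishingIdeal K S)

/-- `Ω` is a (Zariski) dense subset of `Z`. -/
def IsDenseSubset {σ : Type*} (Ω Z : Set (σ → K)) : Prop :=
  Ω ⊆ Z ∧ Z ⊆ zariskiClosure Ω

/-- An irreducible affine surface in `K³`: the zero set of an irreducible polynomial in three
variables (its defining polynomial). -/
def IsAffineSurface (Z : Set (Fin 3 → K)) : Prop :=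
  ∃ f : MvPolynomial (Fin 3) K, Irreducible f ∧ Z = {p | MvPolynomial.eval p f = 0}

/-- A plane in `K³`. -/
def IsPlane (Z : Set (Fin 3 → K)) : Prop :=
  ∃ (u : Fin 3 → K) (e : K), u ≠ 0 ∧ Z = {p | u 0 * p 0 + u 1 * p 1 + u 2 * p 2 = e}

/-- A plane parallel to one of the three coordinate planes. -/
def IsCoordinateParallelPlane (Z : Set (Fin 3 → K)) : Prop :=
  ∃ (i : Fin 3) (e : K), Z = {p | p i = e}

/-- `(N₁/D₁, N₂/D₂, N₃/D₃)`, with `N i, D i ∈ K[t, s]`, is a rational parametrization of `Z` in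
reduced form: the fractions are in lowest terms, and the points that they take as values (where
all denominators are nonzero) lie on `Z` and are Zariski dense in `Z`. The map need not be
generically injective. -/
structure IsReducedParametrization (N D : Fin 3 → MvPolynomial (Fin 2) K)
    (Z : Set (Fin 3 → K)) : Prop where
  den_ne_zero : ∀ i, D i ≠ 0
  reduced : ∀ i, IsRelPrime (N i) (D i)
  dense : IsDenseSubset
    {p : Fin 3 → K | ∃ τ : Fin 2 → K, (∀ i, MvPolynomial.eval τ (D i) ≠ 0) ∧
      ∀ i, p i = MvPolynomial.eval τ (N i) / MvPolynomial.eval τ (D i)} Z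

/-- The field `K(t, s)`. -/
abbrev RatFun (K : Type*) [Field K] : Type _ := FractionRing (MvPolynomial (Fin 2) K)

/-- The ring `K[h₁, h₂][t, s]`: the outer variables are `t, s`, the inner ones `h₁, h₂`. -/
abbrev DoubledPoly (K : Type*) [Field K] : Type _ :=
  MvPolynomial (Fin 2) (MvPolynomial (Fin 2) K)

/-- The inclusion `K(t, s) → K(h₁, h₂, t, s)`, `χ ↦ χ(t, s)`. -/
def inTS : RatFun K →+* FractionRing (DoubledPoly K) :=
  IsFractionRing.map (j := (MvPolynomial.map MvPolynomial.C :
      MvPolynomial (Fin 2) K →+* DoubledPoly K))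
    (MvPolynomial.map_injective _ (MvPolynomial.C_injective (Fin 2) K))

/-- The substitution `K(t, s) → K(h₁, h₂, t, s)`, `χ ↦ χ(h₁, h₂)`. -/
def inH : RatFun K →+* FractionRing (DoubledPoly K) :=
  IsFractionRing.map (j := (MvPolynomial.C : MvPolynomial (Fin 2) K →+* DoubledPoly K))
    (MvPolynomial.C_injective (Fin 2) (MvPolynomial (Fin 2) K))

/-- A polynomial in `t, s` as an element of `K(t, s)`. -/
def toRat (p : MvPolynomial (Fin 2) K) : RatFun K := algebraMap _ _ p

/-- The rational function `(N_j - a_j D_j) / (N₁ - a₁ D₁) * (D₁ / D_j)`, with indices of the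
coordinates in `Fin 3`; so `j = 1` and `j = 2` are the two components `χ₁`, `χ₂` of the
projection from `A`. -/
def chi (N D : Fin 3 → MvPolynomial (Fin 2) K) (A : Fin 3 → K) (j : Fin 3) : RatFun K :=
  toRat (N j - MvPolynomial.C (A j) * D j) / toRat (N 0 - MvPolynomial.C (A 0) * D 0) *
    (toRat (D 0) / toRat (D j))

/-- The numerator, in reduced form, of `χ(t, s) - χ(h₁, h₂)`. -/
def diffNumer (χ : RatFun K) : DoubledPoly K :=
  IsFractionRing.num (DoubledPoly K) (inTS χ - inH χ)

/-- A greatest common divisor in `K[h₁, h₂][t, s]` (unique up to a nonzero constant). -/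
def polyGcd (p q : DoubledPoly K) : DoubledPoly K :=
  (UniqueFactorizationMonoid.toGCDMonoid (DoubledPoly K)).gcd p q

/-- The gcd of the two numerators if it has positive degree in `t, s`, and `1` otherwise.
The `totalDegree` is that of a polynomial in `t, s` with coefficients in `K[h₁, h₂]`. -/
def gPoly (N D : Fin 3 → MvPolynomial (Fin 2) K) (A : Fin 3 → K) : DoubledPoly K :=
  let k := polyGcd (diffNumer (chi N D A 1)) (diffNumer (chi N D A 2))
  if 0 < MvPolynomial.totalDegree k then k else 1

end RationalSurface

end

/-! Let `L = K(t, s)` and let `x` in `L³` be the generic point of the surface. The functions `χ₁`,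
`χ₂` are the slopes `(x_j - a_j) / (x_0 - a_0)`, the coordinates of the projection from `A`.

From the gcd to a plane: let `p` be a prime common factor of the two numerators, of positive degree
in `t, s`. The rational functions whose values at `(t, s)` and `(h₁, h₂)` agree modulo `p` form a
subfield of `L` containing `χ₁` and `χ₂`. Were `L` algebraic over it, `p` would involve neither `t`
nor `s`. Hence some nonzero derivation `δ` of `L` kills both slopes
(`exists_derivation_of_common_factor`). Differentiating the slopes shows that `δ x` is a multiple of
`x - A`, and the multiple is nonzero because the coordinates have transcendence degree two; after
rescaling, `δ x = x - A`.

The derivations of `L` over `K` have dimension at most two over `L`, so a single nonzero `L`-linear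
form `n` on `L³` kills every `δ x`. Thus `n(A) = n(x)` for all `A` in `Ω`. Composing with a
`K`-linear form on `L` turns this into one linear equation over `K` satisfied by `Ω`, hence by `Z`.

From a plane to the gcd: the equation of the plane is an affine relation between the slopes, so one
numerator divides the other. A numerator vanishes on the diagonal, so it has positive degree in `t,
s` unless its slope is constant; both slopes cannot be constant, since `Z` is not a line. -/

namespace RationalSurface

open MvPolynomial

/-! ### Derivations of field extensions in characteristic zero -/

/-- The constants of a derivation of a field extension. -/
def constants {F E : Type*} [Field F] [Field E] [Algebra F E] (δ : Derivation F E E) :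
    IntermediateField F E where
  carrier := {c | δ c = 0}
  mul_mem' {a b} ha hb := by
    simp only [Set.mem_ofPred_eq] at *
    simp [ha, hb]
  add_mem' {a b} ha hb := by
    simp only [Set.mem_ofPred_eq] at *
    simp [ha, hb]
  algebraMap_mem' r := by simp
  inv_mem' a ha := by
    simp only [Set.mem_ofPred_eq] at *
    simp [Derivation.leibniz_inv, ha]

/-- A derivation of a field extension is linear over its constants. -/
def overConstants {F E : Type*} [Field F] [Field E] [Algebra F E] (δ : Derivation F E E)
    (S : IntermediateField F E) (hS : S ≤ constants δ) : Derivation S E E where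
  toFun := δ
  map_add' := map_add δ
  map_smul' c x := by
    have : δ (c : E) = 0 := hS c.2
    simp [Algebra.smul_def, this, IntermediateField.algebraMap_apply]
  map_one_eq_zero' := by simp
  leibniz' a b := δ.leibniz a b

/-- In characteristic zero an algebraic extension is separable, so its Kähler differentials vanish.
-/
theorem eq_zero_of_isAlgebraic_constants {F E : Type*} [Field F] [Field E] [Algebra F E]
    [CharZero F] (δ : Derivation F E E) (S : IntermediateField F E) (hS : S ≤ constants δ)
    [Algebra.IsAlgebraic S E] : δ = 0 := by
  have : CharZero S := charZero_of_injective_algebraMap (algebraMap F S).injective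
  have : Algebra.FormallyUnramified S E := Algebra.FormallyUnramified.of_isSeparable S E
  have h : overConstants δ S hS = 0 :=
    (KaehlerDifferential.linearMapEquivDerivation S E).symm.injective (Subsingleton.elim _ _)
  ext x
  exact congrArg (fun d : Derivation S E E => d x) h

/-- If the Kähler differentials over `S` vanished, the essentially finite extension would be
separable, hence algebraic. A linear form that is nonzero on some differential gives `δ`. -/
theorem exists_derivation_of_not_isAlgebraic {F E : Type*} [Field F] [Field E] [Algebra F E]
    [Algebra.EssFiniteType F E] (S : IntermediateField F E) (h : ¬ Algebra.IsAlgebraic S E) :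
    ∃ δ : Derivation F E E, δ ≠ 0 ∧ S ≤ constants δ := by
  have : Algebra.EssFiniteType S E := Algebra.EssFiniteType.of_comp F S E
  have hu : ¬ Algebra.FormallyUnramified S E := fun hu => h (by
    have := (Algebra.FormallyUnramified.iff_isSeparable S E).1 hu
    infer_instance)
  have hn : ¬ Subsingleton (Ω[E⁄S]) := fun hs => hu ⟨hs⟩
  rw [not_subsingleton_iff_nontrivial] at hn
  obtain ⟨ω, hω⟩ := exists_ne (0 : Ω[E⁄S])
  obtain ⟨ℓ, hℓ⟩ : ∃ ℓ : Ω[E⁄S] →ₗ[E] E, ℓ ω ≠ 0 := by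
    by_contra! hc
    exact hω ((Module.forall_dual_apply_eq_zero_iff E ω).1 hc)
  let δ : Derivation S E E := KaehlerDifferential.linearMapEquivDerivation S E ℓ
  have hδ : δ ≠ 0 := by
    intro h0
    have : ℓ = 0 := (KaehlerDifferential.linearMapEquivDerivation S E).injective
      (h0.trans (map_zero _).symm)
    exact hℓ (by simp [this])
  refine ⟨δ.restrictScalars F, ?_, fun c hc => ?_⟩
  · intro h0
    apply hδ
    ext x
    exact congrArg (fun d : Derivation F E E => d x) h0
  · have := δ.map_algebraMap (⟨c, hc⟩ : S)
    exact this

/-! ### The field of rational functions in two variables -/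

variable {K : Type*} [Field K]

theorem trdeg_ratFun : Algebra.trdeg K (RatFun K) = 2 := by
  have h := trdeg_add_eq K (MvPolynomial (Fin 2) K) (A := RatFun K)
  have : Algebra.IsAlgebraic (MvPolynomial (Fin 2) K) (RatFun K) :=
    IsLocalization.isAlgebraic _ (nonZeroDivisors (MvPolynomial (Fin 2) K))
  rw [trdeg_eq_zero (R := MvPolynomial (Fin 2) K), MvPolynomial.trdeg_of_isDomain] at h
  simpa using h.symm

theorem exists_eq_toRat_div (c : RatFun K) :
    ∃ p q : MvPolynomial (Fin 2) K, q ≠ 0 ∧ c * toRat q = toRat p := by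
  obtain ⟨p, q, hq, h⟩ := IsFractionRing.div_surjective (A := MvPolynomial (Fin 2) K) c
  refine ⟨p, q, nonZeroDivisors.ne_zero hq, ?_⟩
  rw [← h]
  exact div_mul_cancel₀ _ (IsFractionRing.to_map_ne_zero_of_mem_nonZeroDivisors hq)

theorem toRat_injective : Function.Injective (toRat : MvPolynomial (Fin 2) K → RatFun K) :=
  IsFractionRing.injective _ _

theorem toRat_eq_zero {p : MvPolynomial (Fin 2) K} : toRat p = 0 ↔ p = 0 :=
  ⟨fun h => toRat_injective (h.trans (map_zero (algebraMap _ (RatFun K))).symm),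
    fun h => h ▸ map_zero (algebraMap _ (RatFun K))⟩

@[simp] theorem toRat_mul (p q : MvPolynomial (Fin 2) K) : toRat (p * q) = toRat p * toRat q :=
  map_mul (algebraMap _ (RatFun K)) p q

@[simp] theorem toRat_add (p q : MvPolynomial (Fin 2) K) : toRat (p + q) = toRat p + toRat q :=
  map_add (algebraMap _ (RatFun K)) p q

@[simp] theorem toRat_sub (p q : MvPolynomial (Fin 2) K) : toRat (p - q) = toRat p - toRat q :=
  map_sub (algebraMap _ (RatFun K)) p q

theorem toRat_C (a : K) : toRat (C a) = algebraMap K (RatFun K) a :=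
  (IsScalarTower.algebraMap_apply K (MvPolynomial (Fin 2) K) (RatFun K) a).symm

theorem derivation_eq_zero (δ : Derivation K (RatFun K) (RatFun K))
    (h : ∀ i, δ (toRat (X i)) = 0) : δ = 0 := by
  have hp : ∀ p, toRat p ∈ constants δ := by
    intro p
    induction p using MvPolynomial.induction_on with
    | C a => rw [toRat_C]; exact (constants δ).algebraMap_mem a
    | add p q hp hq => rw [toRat_add]; exact add_mem hp hq
    | mul_X p i hp => rw [toRat_mul]; exact mul_mem hp (h i)
  ext c
  obtain ⟨p, q, hq, hc⟩ := exists_eq_toRat_div c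
  have : c = toRat p / toRat q := by
    rw [eq_div_iff (fun h => hq (toRat_eq_zero.1 h)), hc]
  rw [this]
  exact div_mem (hp p) (hp q)

/-- A derivation is determined by its values at `t` and `s`, so the space of derivations embeds in
`L²`. -/
theorem finrank_derivation_image_le {ι : Type*} [Finite ι] (x : ι → RatFun K) :
    ∃ V : Submodule (RatFun K) (ι → RatFun K), Module.finrank (RatFun K) V ≤ 2 ∧
      ∀ δ : Derivation K (RatFun K) (RatFun K), (fun i => δ (x i)) ∈ V := by
  let f : Derivation K (RatFun K) (RatFun K) →ₗ[RatFun K] (Fin 2 → RatFun K) :=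
    { toFun := fun δ i => δ (toRat (X i))
      map_add' := fun _ _ => rfl
      map_smul' := fun _ _ => rfl }
  have hf : Function.Injective f := by
    rw [injective_iff_map_eq_zero]
    exact fun δ hδ => derivation_eq_zero δ (fun i => congrFun hδ i)
  let g : Derivation K (RatFun K) (RatFun K) →ₗ[RatFun K] (ι → RatFun K) :=
    { toFun := fun δ i => δ (x i)
      map_add' := fun _ _ => rfl
      map_smul' := fun _ _ => rfl }
  have : Module.Finite (RatFun K) (Derivation K (RatFun K) (RatFun K)) :=
    Module.Finite.of_injective f hf
  refine ⟨LinearMap.range g, (LinearMap.finrank_range_le g).trans ?_,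
    fun δ => ⟨δ, rfl⟩⟩
  simpa using LinearMap.finrank_le_finrank_of_injective hf

theorem derivation_eq_zero_of_algebraicIndependent [CharZero K] {v : Fin 2 → RatFun K}
    (hv : AlgebraicIndependent K v) (δ : Derivation K (RatFun K) (RatFun K))
    (h : ∀ i, δ (v i) = 0) : δ = 0 := by
  have hb : IsTranscendenceBasis K v :=
    hv.isTranscendenceBasis_of_lift_trdeg_le_of_finite (by rw [trdeg_ratFun]; simp)
  have := hb.isAlgebraic_field
  refine eq_zero_of_isAlgebraic_constants δ (IntermediateField.adjoin K (Set.range v)) ?_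
  rw [IntermediateField.adjoin_le_iff]
  rintro _ ⟨i, rfl⟩
  exact h i

/-! ### Specialisation of rational functions -/

/-- The graph of the partially defined extension to the fraction field of a ring homomorphism into
a field. -/
def specialization {R κ : Type*} [CommRing R] [IsDomain R] [Field κ] (φ : R →+* κ) :
    Subring (FractionRing R × κ) where
  carrier := {x | ∃ p q : R, φ q ≠ 0 ∧ x.1 * algebraMap R (FractionRing R) q = algebraMap R _ p ∧
    x.2 * φ q = φ p}
  mul_mem' := by
    rintro ⟨a, b⟩ ⟨c, d⟩ ⟨p, q, hq, h1, h2⟩ ⟨p', q', hq', h1', h2'⟩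
    refine ⟨p * p', q * q', by simp [hq, hq'], ?_, ?_⟩
    · simp only [map_mul, Prod.fst_mul, ← h1, ← h1']; ring
    · simp only [map_mul, Prod.snd_mul, ← h2, ← h2']; ring
  one_mem' := ⟨1, 1, by simp, by simp, by simp⟩
  add_mem' := by
    rintro ⟨a, b⟩ ⟨c, d⟩ ⟨p, q, hq, h1, h2⟩ ⟨p', q', hq', h1', h2'⟩
    refine ⟨p * q' + p' * q, q * q', by simp [hq, hq'], ?_, ?_⟩
    · simp only [map_mul, map_add, Prod.fst_add, ← h1, ← h1']; ring
    · simp only [map_mul, map_add, Prod.snd_add, ← h2, ← h2']; ring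
  zero_mem' := ⟨0, 1, by simp, by simp, by simp⟩
  neg_mem' := by
    rintro ⟨a, b⟩ ⟨p, q, hq, h1, h2⟩
    exact ⟨-p, q, hq, by simp [← h1], by simp [← h2]⟩

section specialization

variable {R κ : Type*} [CommRing R] [IsDomain R] [Field κ] {φ : R →+* κ}

/-- As `specialization φ` is a subring, this makes the value of a fraction unique. -/
theorem snd_eq_zero_of_mem_specialization {y : κ} (h : ((0 : FractionRing R), y) ∈ specialization φ) :
    y = 0 := by
  obtain ⟨p, q, hq, h1, h2⟩ := h
  have hp : p = 0 := IsFractionRing.injective R (FractionRing R) (by simpa using h1.symm)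
  simpa [hp, hq] using h2

theorem algebraMap_mem_specialization (p : R) :
    (algebraMap R (FractionRing R) p, φ p) ∈ specialization φ :=
  ⟨p, 1, by simp, by simp, by simp⟩

theorem inv_mem_specialization {x : FractionRing R} {y : κ} (h : (x, y) ∈ specialization φ)
    (hy : y ≠ 0) : (x⁻¹, y⁻¹) ∈ specialization φ := by
  obtain ⟨p, q, hq, h1, h2⟩ := h
  have hx : x ≠ 0 := by
    rintro rfl
    exact hy (snd_eq_zero_of_mem_specialization ⟨p, q, hq, h1, h2⟩)
  refine ⟨q, p, ?_, ?_, ?_⟩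
  · rw [← h2]; exact mul_ne_zero hy hq
  · rw [← h1]; exact inv_mul_cancel_left₀ hx _
  · rw [← h2]; exact inv_mul_cancel_left₀ hy _

theorem div_mem_specialization {p q : R} (hq : φ q ≠ 0) :
    (algebraMap R (FractionRing R) p / algebraMap R _ q, φ p / φ q) ∈ specialization φ := by
  have := mul_mem (algebraMap_mem_specialization (φ := φ) p)
    (inv_mem_specialization (algebraMap_mem_specialization (φ := φ) q) hq)
  simpa [div_eq_mul_inv] using this

end specialization

/-! ### Polynomials vanishing on a surface -/

theorem exists_eq_C_of_degreeOf_eq_zero {σ R : Type*} [CommRing R] {p : MvPolynomial σ R}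
    (h : ∀ i, p.degreeOf i = 0) : p = C (p.coeff 0) := by
  rw [← totalDegree_eq_zero_iff_eq_C, totalDegree_eq_zero_iff]
  intro m hm i
  by_contra hi
  exact (Nat.pos_of_ne_zero hi).not_ge ((le_degreeOf_of_mem_support i hm).trans (h i).le)

theorem not_eq_C_of_irreducible {σ : Type*} {f : MvPolynomial σ K} (hf : Irreducible f) (c : K) :
    f ≠ C c := by
  rintro rfl
  have hc : c ≠ 0 := by
    rintro rfl
    exact hf.ne_zero (map_zero C)
  exact hf.not_isUnit ((isUnit_iff_ne_zero.2 hc).map C)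

theorem dvd_of_forall_eval_eq_zero [IsAlgClosed K] {σ : Type*} [Finite σ] {f P : MvPolynomial σ K}
    (hf : Irreducible f) (h : ∀ p, eval p f = 0 → eval p P = 0) : f ∣ P := by
  have : (Ideal.span {f}).IsPrime := (Ideal.span_singleton_prime hf.ne_zero).2 hf.prime
  rw [← Ideal.mem_span_singleton, ← IsPrime.vanishingIdeal_zeroLocus (K := K) (Ideal.span {f})]
  intro p hp
  rw [zeroLocus_span] at hp
  exact h p (by simpa [aeval_eq_eval] using hp f rfl)

/-- The equation of a plane. -/
noncomputable def planePoly (u : Fin 3 → K) (e : K) : MvPolynomial (Fin 3) K :=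
  C (u 0) * X 0 + C (u 1) * X 1 + C (u 2) * X 2 - C e

theorem eval_planePoly (u : Fin 3 → K) (e : K) (p : Fin 3 → K) :
    eval p (planePoly u e) = u 0 * p 0 + u 1 * p 1 + u 2 * p 2 - e := by
  simp [planePoly]

theorem planePoly_ne_zero {u : Fin 3 → K} (hu : u ≠ 0) (e : K) : planePoly u e ≠ 0 := by
  intro h
  have h0 : e = 0 := by
    have := eval_planePoly u e 0
    simpa [h] using this
  apply hu
  ext i
  have := eval_planePoly u e (Pi.single i 1)
  rw [h, h0] at this
  fin_cases i <;> simpa using this.symm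

theorem totalDegree_planePoly_le (u : Fin 3 → K) (e : K) : (planePoly u e).totalDegree ≤ 1 := by
  have h : ∀ i, (C (u i) * X i : MvPolynomial (Fin 3) K).totalDegree ≤ 1 := fun i =>
    (totalDegree_mul _ _).trans (by simp)
  refine (totalDegree_sub _ _).trans (max_le ?_ (by simp))
  refine (totalDegree_add _ _).trans (max_le ?_ (h 2))
  exact (totalDegree_add _ _).trans (max_le (h 0) (h 1))

/-- By the Nullstellensatz the irreducible equation divides the linear one; comparing degrees, the
cofactor is a nonzero constant. -/
theorem IsAffineSurface.eq_plane_of_subset [IsAlgClosed K] {Z : Set (Fin 3 → K)}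
    (hZ : IsAffineSurface Z) {u : Fin 3 → K} (hu : u ≠ 0) {e : K}
    (h : ∀ p ∈ Z, u 0 * p 0 + u 1 * p 1 + u 2 * p 2 = e) :
    Z = {p | u 0 * p 0 + u 1 * p 1 + u 2 * p 2 = e} := by
  obtain ⟨f, hf, rfl⟩ := hZ
  obtain ⟨g, hg⟩ : f ∣ planePoly u e := dvd_of_forall_eval_eq_zero hf fun p hp => by
    rw [eval_planePoly, h p hp, sub_self]
  have hne := planePoly_ne_zero hu e
  have hg0 : g ≠ 0 := by
    rintro rfl
    exact hne (by simpa using hg)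
  have hdeg := totalDegree_planePoly_le u e
  rw [hg, totalDegree_mul_of_isDomain hf.ne_zero hg0] at hdeg
  have hfdeg : f.totalDegree ≠ 0 := fun h0 =>
    not_eq_C_of_irreducible hf _ (totalDegree_eq_zero_iff_eq_C.1 h0)
  have hgC := totalDegree_eq_zero_iff_eq_C.1 (show g.totalDegree = 0 by lia)
  refine Set.Subset.antisymm h fun p hp => ?_
  have h1 := eval_planePoly u e p
  rw [hg, hgC, show u 0 * p 0 + u 1 * p 1 + u 2 * p 2 = e from hp, sub_self, map_mul, eval_C] at h1
  refine (mul_eq_zero.1 h1).resolve_right fun hc => hg0 ?_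
  rw [hgC, hc, map_zero]

/-! ### The generic point of a parametrization -/

/-- The coordinates of a parametrization as rational functions. -/
noncomputable def coordFun (N D : Fin 3 → MvPolynomial (Fin 2) K) (i : Fin 3) : RatFun K :=
  toRat (N i) / toRat (D i)

section param

variable {N D : Fin 3 → MvPolynomial (Fin 2) K} {Z : Set (Fin 3 → K)}

theorem aeval_coordFun_mem_specialization {τ : Fin 2 → K} (hτ : ∀ i, eval τ (D i) ≠ 0)
    (P : MvPolynomial (Fin 3) K) :
    (aeval (coordFun N D) P, eval (fun i => eval τ (N i) / eval τ (D i)) P) ∈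
      specialization (eval τ) := by
  induction P using MvPolynomial.induction_on with
  | C a =>
    have := algebraMap_mem_specialization (φ := eval τ) (C a)
    rw [eval_C] at this
    rw [eval_C, aeval_C, ← toRat_C]
    exact this
  | add p q hp hq => simpa using add_mem hp hq
  | mul_X p i hp =>
    have := mul_mem hp (div_mem_specialization (p := N i) (hτ i))
    simpa [coordFun, toRat] using this

theorem IsReducedParametrization.eval_eq_zero (hQ : IsReducedParametrization N D Z)
    {P : MvPolynomial (Fin 3) K} (hP : aeval (coordFun N D) P = 0) {p : Fin 3 → K} (hp : p ∈ Z) :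
    eval p P = 0 := by
  have := hQ.dense.2 hp P
  rw [aeval_eq_eval] at this
  refine this ?_
  rintro x ⟨τ, hτ, hx⟩
  obtain rfl : x = fun i => eval τ (N i) / eval τ (D i) := funext hx
  have hs := aeval_coordFun_mem_specialization (N := N) hτ P
  rw [hP] at hs
  rw [aeval_eq_eval]
  exact snd_eq_zero_of_mem_specialization hs

theorem IsReducedParametrization.aeval_eq_zero [Infinite K] (hQ : IsReducedParametrization N D Z)
    {P : MvPolynomial (Fin 3) K} (hP : ∀ p ∈ Z, eval p P = 0) : aeval (coordFun N D) P = 0 := by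
  obtain ⟨p, q, hq, h⟩ := exists_eq_toRat_div (aeval (coordFun N D) P)
  -- The factor `∏ i, D i` takes care of the points where the parametrization is undefined.
  have hp : p * ∏ i, D i = 0 := by
    refine MvPolynomial.funext fun τ => ?_
    rw [map_zero, map_mul, map_prod]
    by_cases hτ : ∀ i, eval τ (D i) ≠ 0
    · have hs := aeval_coordFun_mem_specialization (N := N) hτ P
      rw [hP _ (hQ.dense.1 ⟨τ, hτ, fun _ => rfl⟩)] at hs
      obtain ⟨p', q', hq', h1, h2⟩ := hs
      have h3 : p * q' = p' * q := by
        apply toRat_injective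
        rw [toRat_mul, toRat_mul, ← h, show toRat p' = _ from h1.symm]
        simp only [toRat]
        ring
      have h4 : eval τ p' = 0 := by simpa using h2.symm
      have h5 := congrArg (eval τ) h3
      rw [map_mul, map_mul, h4, zero_mul] at h5
      rw [(mul_eq_zero.1 h5).resolve_right hq', zero_mul]
    · push Not at hτ
      obtain ⟨i, hi⟩ := hτ
      rw [Finset.prod_eq_zero (Finset.mem_univ i) hi, mul_zero]
  have hD : ∏ i, D i ≠ 0 := Finset.prod_ne_zero_iff.2 fun i _ => hQ.den_ne_zero i
  rw [(mul_eq_zero.1 hp).resolve_right hD, toRat_eq_zero.2 rfl] at h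
  exact (mul_eq_zero.1 h).resolve_right fun h0 => hq (toRat_eq_zero.1 h0)

theorem aeval_planePoly {E : Type*} [CommRing E] [Algebra K E] (u : Fin 3 → K) (e : K)
    (x : Fin 3 → E) : aeval x (planePoly u e) = algebraMap K E (u 0) * x 0 +
      algebraMap K E (u 1) * x 1 + algebraMap K E (u 2) * x 2 - algebraMap K E e := by
  simp [planePoly]

/-- The coordinates satisfy a linear equation only if the surface is the corresponding plane. -/
theorem IsReducedParametrization.eq_plane [IsAlgClosed K] (hZ : IsAffineSurface Z)
    (hQ : IsReducedParametrization N D Z) {u : Fin 3 → K} (hu : u ≠ 0) {e : K}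
    (h : aeval (coordFun N D) (planePoly u e) = 0) :
    Z = {p | u 0 * p 0 + u 1 * p 1 + u 2 * p 2 = e} :=
  hZ.eq_plane_of_subset hu fun p hp => by
    have := hQ.eval_eq_zero h hp
    rwa [eval_planePoly, sub_eq_zero] at this

theorem IsReducedParametrization.coordFun_zero_ne [IsAlgClosed K] (hZ : IsAffineSurface Z)
    (hpar : ¬ IsCoordinateParallelPlane Z) (hQ : IsReducedParametrization N D Z) (a : K) :
    coordFun N D 0 - algebraMap K (RatFun K) a ≠ 0 := by
  intro h
  refine hpar ⟨0, a, ?_⟩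
  rw [hQ.eq_plane hZ (u := Pi.single 0 1) (e := a) (by simp) (by simpa [aeval_planePoly] using h)]
  simp

/-- The coordinates of a parametrization of a surface generate a field of transcendence degree two,
so that no nonzero derivation vanishes on all of them. -/
theorem IsReducedParametrization.exists_derivation_ne_zero [IsAlgClosed K] [CharZero K]
    (hZ : IsAffineSurface Z) (hQ : IsReducedParametrization N D Z)
    {δ : Derivation K (RatFun K) (RatFun K)} (hδ : δ ≠ 0) : ∃ i, δ (coordFun N D i) ≠ 0 := by
  by_contra! h
  obtain ⟨f, hf, rfl⟩ := hZ
  refine not_eq_C_of_irreducible hf _ (exists_eq_C_of_degreeOf_eq_zero fun i => ?_)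
  -- The two coordinates other than the `i`-th satisfy a relation. The equation `f` divides it, so
  -- `f` has degree zero in `X i`; this holds for every `i`.
  have hdep : ¬ AlgebraicIndependent K (coordFun N D ∘ i.succAbove) := fun hv =>
    hδ (derivation_eq_zero_of_algebraicIndependent hv δ fun j => h _)
  rw [algebraicIndependent_iff] at hdep
  push Not at hdep
  obtain ⟨P, hP, hP0⟩ := hdep
  obtain ⟨g, hg⟩ : f ∣ rename i.succAbove P := dvd_of_forall_eval_eq_zero hf fun p hp =>
    hQ.eval_eq_zero (by rw [aeval_rename, hP]) hp
  have hr : rename i.succAbove P ≠ 0 := fun h0 =>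
    hP0 (rename_injective _ Fin.succAbove_right_injective (by rw [h0, map_zero]))
  have hdeg : (rename i.succAbove P).degreeOf i = 0 := by
    classical
    by_contra h0
    rw [← ne_eq, ← mem_vars_iff_degreeOf_ne_zero] at h0
    obtain ⟨j, -, hj⟩ := Finset.mem_image.1 (vars_rename _ _ h0)
    exact Fin.succAbove_ne i j hj
  rw [hg] at hr hdeg
  rw [degreeOf_mul_eq (left_ne_zero_of_mul hr) (right_ne_zero_of_mul hr)] at hdeg
  lia

theorem chi_eq (hD : ∀ i, D i ≠ 0) (A : Fin 3 → K) (j : Fin 3) :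
    chi N D A j = (coordFun N D j - algebraMap K (RatFun K) (A j)) /
      (coordFun N D 0 - algebraMap K (RatFun K) (A 0)) := by
  have hj : toRat (D j) ≠ 0 := fun h => hD j (toRat_eq_zero.1 h)
  have h0 : toRat (D 0) ≠ 0 := fun h => hD 0 (toRat_eq_zero.1 h)
  simp only [chi, coordFun, toRat_sub, toRat_mul, toRat_C]
  rw [div_sub' hj, div_sub' h0, div_div_div_eq, div_mul_div_comm]
  congr 1
  · ring
  · ring

end param

/-! ### The numerators of the differences -/

theorem inTS_toRat (p : MvPolynomial (Fin 2) K) :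
    inTS (toRat p) = algebraMap (DoubledPoly K) _ (map C p) := by
  simp [inTS, toRat, IsFractionRing.map]

theorem inH_toRat (p : MvPolynomial (Fin 2) K) :
    inH (toRat p) = algebraMap (DoubledPoly K) _ (C p) := by
  simp [inH, toRat, IsFractionRing.map]

theorem diffNumer_mul_eq {χ : RatFun K} {p q : MvPolynomial (Fin 2) K}
    (h : χ * toRat q = toRat p) :
    diffNumer χ * (map C q * C q) =
      (map C p * C q - C p * map C q) *
        (IsFractionRing.den (DoubledPoly K) (inTS χ - inH χ) : DoubledPoly K) := by
  have hx : algebraMap (DoubledPoly K) (FractionRing (DoubledPoly K)) (diffNumer χ) =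
      (inTS χ - inH χ) *
        algebraMap _ _ (IsFractionRing.den (DoubledPoly K) (inTS χ - inH χ) : DoubledPoly K) := by
    have := IsFractionRing.mk'_num_den' (DoubledPoly K) (inTS χ - inH χ)
    rw [div_eq_iff (IsFractionRing.to_map_ne_zero_of_mem_nonZeroDivisors
      (IsFractionRing.den (DoubledPoly K) _).2)] at this
    exact this
  have h1 := congrArg inTS h
  have h2 := congrArg inH h
  rw [map_mul, inTS_toRat, inTS_toRat] at h1
  rw [map_mul, inH_toRat, inH_toRat] at h2
  apply IsFractionRing.injective (DoubledPoly K) (FractionRing (DoubledPoly K))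
  simp only [map_mul, map_sub, hx, ← h1, ← h2]
  ring

theorem diffNumer_eq_zero_iff {χ : RatFun K} : diffNumer χ = 0 ↔ inTS χ = inH χ := by
  rw [diffNumer, IsFractionRing.num_eq_zero, sub_eq_zero]

/-- Specialise `(h₁, h₂)` to a point where the denominator does not vanish. -/
theorem exists_eq_const_of_inTS_eq_inH [Infinite K] {χ : RatFun K} (h : inTS χ = inH χ) :
    ∃ c : K, χ = algebraMap K (RatFun K) c := by
  obtain ⟨p, q, hq, hpq⟩ := exists_eq_toRat_div χ
  have h1 := congrArg inTS hpq
  have h2 := congrArg inH hpq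
  rw [map_mul, inTS_toRat, inTS_toRat] at h1
  rw [map_mul, inH_toRat, inH_toRat] at h2
  have h3 : (map C p * C q : DoubledPoly K) = C p * map C q := by
    apply IsFractionRing.injective (DoubledPoly K) (FractionRing (DoubledPoly K))
    simp only [map_mul, ← h1, ← h2, h]
    ring
  obtain ⟨η, hη⟩ : ∃ η, eval η q ≠ 0 := by
    by_contra! hc
    exact hq (MvPolynomial.funext fun η => by rw [hc, map_zero])
  have h4 := congrArg (map (eval η)) h3
  have hC : (eval η).comp C = RingHom.id K := by ext; simp
  simp only [map_mul, map_map, map_C, hC, map_id] at h4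
  have h5 := congrArg toRat h4
  simp only [toRat_mul, toRat_C, ← hpq] at h5
  refine ⟨eval η p / eval η q, ?_⟩
  have hq' : toRat q ≠ 0 := fun h => hq (toRat_eq_zero.1 h)
  have hη' : algebraMap K (RatFun K) (eval η q) ≠ 0 := by simpa using hη
  rw [map_div₀, eq_div_iff hη']
  apply mul_right_cancel₀ hq'
  rw [← h5]
  ring

/-- The numerator of `χ(t, s) - χ(h₁, h₂)` vanishes on the diagonal, so that it cannot be a nonzero
polynomial in `h₁, h₂` alone. -/
theorem totalDegree_diffNumer_pos [Infinite K] {χ : RatFun K}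
    (h : ∀ c : K, χ ≠ algebraMap K (RatFun K) c) : 0 < (diffNumer χ).totalDegree := by
  rw [Nat.pos_iff_ne_zero]
  intro h0
  obtain ⟨p, q, hq, hpq⟩ := exists_eq_toRat_div χ
  -- Evaluating at `X` substitutes `h₁, h₂` for `t, s`: the restriction to the diagonal.
  have h1 := congrArg (eval X) (diffNumer_mul_eq hpq)
  rw [totalDegree_eq_zero_iff_eq_C.1 h0] at h1
  have hX : ∀ r : MvPolynomial (Fin 2) K, eval X (map C r) = r := fun r => by
    rw [eval_map, eval₂_eta]
  simp only [map_mul, map_sub, eval_C, hX, sub_self, zero_mul] at h1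
  have hc := (mul_eq_zero.1 h1).resolve_right (mul_ne_zero hq hq)
  obtain ⟨c, hc⟩ := exists_eq_const_of_inTS_eq_inH (χ := χ) (diffNumer_eq_zero_iff.1 (by
    rw [totalDegree_eq_zero_iff_eq_C.1 h0, hc, map_zero]))
  exact h c hc

theorem exists_prime_dvd_totalDegree_pos {σ R : Type*} [CommRing R] [IsDomain R]
    [UniqueFactorizationMonoid (MvPolynomial σ R)] (k : MvPolynomial σ R) :
    0 < k.totalDegree → ∃ p, Prime p ∧ p ∣ k ∧ 0 < p.totalDegree := by
  induction k using UniqueFactorizationMonoid.induction_on_prime with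
  | h₁ => simp
  | h₂ x hx => rw [(isUnit_iff_totalDegree_of_isReduced.1 hx).2]; simp
  | h₃ a p ha hp ih =>
    intro h
    rw [totalDegree_mul_of_isDomain hp.ne_zero ha] at h
    by_cases h0 : 0 < p.totalDegree
    · exact ⟨p, hp, dvd_mul_right p a, h0⟩
    · obtain ⟨r, hr, hra, hr0⟩ := ih (by lia)
      exact ⟨r, hr, hra.mul_left p, hr0⟩

theorem not_dvd_C_of_totalDegree_pos {σ R : Type*} [CommRing R] [IsDomain R]
    {k : MvPolynomial σ R} (hk : 0 < k.totalDegree) {r : R} (hr : r ≠ 0) : ¬ k ∣ C r := by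
  rintro ⟨g, hg⟩
  have h0 : k * g ≠ 0 := by rw [← hg]; simpa using hr
  have := congrArg totalDegree hg
  rw [totalDegree_C, totalDegree_mul_of_isDomain (left_ne_zero_of_mul h0)
    (right_ne_zero_of_mul h0)] at this
  lia

/-- A polynomial in `h₁, h₂, t, s` that divides two coprime polynomials in `t, s` has degree zero in
`t, s`. -/
theorem totalDegree_eq_zero_of_dvd_map_C [Infinite K] {k : DoubledPoly K}
    {p q : MvPolynomial (Fin 2) K} (hpq : IsRelPrime p q) (hp : k ∣ map C p) (hq : k ∣ map C q) :
    k.totalDegree = 0 := by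
  -- Each specialisation of `h₁, h₂` turns `k` into a common divisor of `p` and `q`. So every
  -- nonconstant coefficient of `k` vanishes at all `η`.
  have hunit : ∀ η : Fin 2 → K, IsUnit (map (eval η) k) := by
    intro η
    have hC : (eval η).comp C = RingHom.id K := by ext; simp
    have h : ∀ r : MvPolynomial (Fin 2) K, map (eval η) (map C r) = r := fun r => by
      rw [map_map, hC, map_id]
    have hp' := map_dvd (map (eval η)) hp
    have hq' := map_dvd (map (eval η)) hq
    rw [h] at hp' hq'
    exact hpq hp' hq'
  rw [totalDegree_eq_zero_iff]
  intro m hm i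
  by_contra hi
  refine mem_support_iff.1 hm (MvPolynomial.funext fun η => ?_)
  have h0 := (isUnit_iff_totalDegree_of_isReduced.1 (hunit η)).2
  rw [totalDegree_eq_zero_iff] at h0
  rw [map_zero, ← coeff_map]
  by_contra hc
  exact hi (h0 m (mem_support_iff.2 hc) i)

/-! ### Common factors of the numerators -/

section residue

variable {κ : Type*} [Field κ] {k : DoubledPoly K} {π : DoubledPoly K →+* κ}

theorem comp_C_injective (hπ : ∀ a, π a = 0 ↔ k ∣ a) (hk : 0 < k.totalDegree) :
    Function.Injective (π.comp C) := by
  rw [injective_iff_map_eq_zero]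
  intro r hr
  by_contra h0
  exact not_dvd_C_of_totalDegree_pos hk h0 ((hπ _).1 hr)

/-- The rational functions whose values at `(t, s)` and `(h₁, h₂)` agree in the residue field of an
irreducible polynomial of positive degree in `t, s`. -/
def agreeing (π : DoubledPoly K →+* κ) (h : Function.Injective (π.comp C)) :
    IntermediateField K (RatFun K) where
  carrier := {c | (c, IsFractionRing.lift h c) ∈ specialization (π.comp (map C))}
  mul_mem' {a b} ha hb := by
    have := Subring.mul_mem (specialization _) ha hb
    simpa using this
  add_mem' {a b} ha hb := by
    have := Subring.add_mem (specialization _) ha hb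
    simpa using this
  algebraMap_mem' r := by
    have := algebraMap_mem_specialization (φ := π.comp (map C)) (C r)
    have h1 : IsFractionRing.lift h (toRat (C r)) = π (C (C r)) :=
      IsFractionRing.lift_algebraMap h _
    rw [Set.mem_ofPred_eq, ← toRat_C, h1]
    simpa [toRat] using this
  inv_mem' a ha := by
    by_cases h0 : a = 0
    · subst h0
      rw [inv_zero]
      exact ha
    · have := inv_mem_specialization ha (by simpa using h0)
      simpa using this

theorem mem_agreeing_of_dvd_diffNumer [Infinite K] (hprime : Prime k)
    (hπ : ∀ a, π a = 0 ↔ k ∣ a) (hk : 0 < k.totalDegree) {χ : RatFun K} (hχ : k ∣ diffNumer χ) :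
    χ ∈ agreeing π (comp_C_injective hπ hk) := by
  have hinj := comp_C_injective hπ hk
  obtain ⟨p, q, hpq, hmk⟩ := IsFractionRing.exists_reduced_fraction (A := MvPolynomial (Fin 2) K) χ
  have hq : (q : MvPolynomial (Fin 2) K) ≠ 0 := nonZeroDivisors.ne_zero q.2
  have hχq : χ * toRat (q : MvPolynomial (Fin 2) K) = toRat p := by
    rw [← hmk]; exact IsLocalization.mk'_spec _ p q
  have hden : ¬ k ∣ IsFractionRing.den (DoubledPoly K) (inTS χ - inH χ) := fun hd =>
    hprime.not_isUnit (IsFractionRing.num_den_reduced (DoubledPoly K) (inTS χ - inH χ) hχ hd)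
  have hdvd : k ∣ map C p * C (q : MvPolynomial (Fin 2) K) - C p * map C q.1 :=
    (hprime.dvd_or_dvd (diffNumer_mul_eq hχq ▸ hχ.mul_right _)).resolve_right hden
  have heq := (hπ _).2 hdvd
  rw [map_sub, map_mul, map_mul, sub_eq_zero] at heq
  have hqh : π (C (q : MvPolynomial (Fin 2) K)) ≠ 0 := fun h0 => hq (hinj (by simpa using h0))
  -- This is where lowest terms matter: if `q(t, s)` vanished modulo `k`, so would `p(t, s)`,
  -- against coprimality.
  have hqt : π (map C (q : MvPolynomial (Fin 2) K)) ≠ 0 := by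
    intro h0
    have hp0 : π (map C p) = 0 := by
      rw [h0, mul_zero] at heq
      exact (mul_eq_zero.1 heq).resolve_right hqh
    exact hk.ne' (totalDegree_eq_zero_of_dvd_map_C hpq ((hπ _).1 hp0) ((hπ _).1 h0))
  have hl : ∀ r : MvPolynomial (Fin 2) K, IsFractionRing.lift hinj (toRat r) = π (C r) :=
    fun r => IsFractionRing.lift_algebraMap hinj _
  have hv := congrArg (IsFractionRing.lift hinj) hχq
  rw [map_mul, hl, hl] at hv
  refine ⟨p, q, hqt, hχq, mul_right_cancel₀ hqh ?_⟩
  change _ * π (map C q.1) * _ = π (map C p) * _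
  rw [heq, ← hv]
  ring

/-- An equation of the `i`-th variable over the agreeing field specialises to one over `K(h₁, h₂)`
for its residue class. Clearing denominators, `k` divides a nonzero polynomial in `X i` alone. -/
theorem degreeOf_eq_zero_of_isAlgebraic (hπ : ∀ a, π a = 0 ↔ k ∣ a) (hk : 0 < k.totalDegree)
    [Algebra.IsAlgebraic (agreeing π (comp_C_injective hπ hk)) (RatFun K)] {i j : Fin 2}
    (hij : j ≠ i) : k.degreeOf j = 0 := by
  have hinj := comp_C_injective hπ hk
  let S := agreeing π hinj
  let φ : RatFun K →+* κ := IsFractionRing.lift hinj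
  obtain ⟨P, hP0, hP⟩ : IsAlgebraic S (toRat (X i) : RatFun K) := Algebra.IsAlgebraic.isAlgebraic _
  let : Algebra (MvPolynomial (Fin 2) K) κ := (π.comp C).toAlgebra
  let : Algebra (RatFun K) κ := φ.toAlgebra
  have : IsScalarTower (MvPolynomial (Fin 2) K) (RatFun K) κ :=
    IsScalarTower.of_algebraMap_eq fun r => (IsFractionRing.lift_algebraMap hinj r).symm
  have hPκ : P.eval₂ (φ.comp (algebraMap S (RatFun K))) (π (X i)) = 0 := by
    have hmem : ∀ P : Polynomial S, (P.eval₂ (algebraMap S (RatFun K)) (toRat (X i)),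
        P.eval₂ (φ.comp (algebraMap S (RatFun K))) (π (X i))) ∈
          specialization (π.comp (map C)) := by
      intro P
      induction P using Polynomial.induction_on' with
      | add p q hp hq => simpa using add_mem hp hq
      | monomial n a =>
        have ha : ((a : RatFun K), φ a) ∈ specialization (π.comp (map C)) := a.2
        have hX := algebraMap_mem_specialization (φ := π.comp (map C)) (X i)
        simpa [toRat] using mul_mem ha (pow_mem hX n)
    have hmem := hmem P
    rw [← Polynomial.aeval_def, hP] at hmem
    exact snd_eq_zero_of_mem_specialization hmem
  have halg : IsAlgebraic (RatFun K) (π (X i)) := by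
    refine ⟨P.map (algebraMap S (RatFun K)), ?_, ?_⟩
    · rwa [ne_eq, Polynomial.map_eq_zero]
    · rw [Polynomial.aeval_def, Polynomial.eval₂_map]
      exact hPκ
  rw [← IsFractionRing.isAlgebraic_iff (MvPolynomial (Fin 2) K)] at halg
  obtain ⟨Q, hQ0, hQ⟩ := halg
  have hQX : (Polynomial.aeval (X i : DoubledPoly K) Q) ≠ 0 := fun h0 =>
    hQ0 ((transcendental_iff.1 (transcendental_X _ i)) Q h0)
  obtain ⟨g, hg⟩ : k ∣ Polynomial.aeval (X i : DoubledPoly K) Q := by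
    rw [← hπ, Polynomial.aeval_def, Polynomial.hom_eval₂]
    exact hQ
  have hdeg : (Polynomial.aeval (X i : DoubledPoly K) Q).degreeOf j = 0 := by
    by_contra h0
    rw [← ne_eq, ← mem_vars_iff_degreeOf_ne_zero] at h0
    have hs : Polynomial.aeval (X i : DoubledPoly K) Q ∈
        supported (MvPolynomial (Fin 2) K) {i} := by
      rw [supported, Set.image_singleton]
      exact Polynomial.aeval_mem_adjoin_singleton _ _
    exact hij (mem_supported.1 hs h0)
  rw [hg] at hQX hdeg
  rw [degreeOf_mul_eq (left_ne_zero_of_mul hQX) (right_ne_zero_of_mul hQX)] at hdeg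
  lia

end residue

/-- If the numerators of `χ(t, s) - χ(h₁, h₂)` and `χ'(t, s) - χ'(h₁, h₂)` have a common factor of
positive degree in `t, s`, then the Jacobian of `(χ, χ')` is degenerate. -/
theorem exists_derivation_of_common_factor [Infinite K] {k : DoubledPoly K}
    (hk : 0 < k.totalDegree) {χ χ' : RatFun K} (h : k ∣ diffNumer χ) (h' : k ∣ diffNumer χ') :
    ∃ δ : Derivation K (RatFun K) (RatFun K), δ ≠ 0 ∧ δ χ = 0 ∧ δ χ' = 0 := by
  obtain ⟨p, hp, hpk, hp0⟩ := exists_prime_dvd_totalDegree_pos k hk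
  have : (Ideal.span {p}).IsPrime := (Ideal.span_singleton_prime hp.ne_zero).2 hp
  let π : DoubledPoly K →+* FractionRing (DoubledPoly K ⧸ Ideal.span {p}) :=
    (algebraMap _ _).comp (Ideal.Quotient.mk (Ideal.span {p}))
  have hπ : ∀ a, π a = 0 ↔ p ∣ a := by
    intro a
    rw [← Ideal.mem_span_singleton, ← Ideal.Quotient.eq_zero_iff_mem]
    exact map_eq_zero_iff _ (IsFractionRing.injective (DoubledPoly K ⧸ Ideal.span {p}) _)
  have hnot : ¬ Algebra.IsAlgebraic (agreeing π (comp_C_injective hπ hp0)) (RatFun K) := by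
    intro halg
    refine hp0.ne' (totalDegree_eq_zero_iff_eq_C.2 (exists_eq_C_of_degreeOf_eq_zero fun j => ?_))
    obtain ⟨i, hij⟩ := exists_ne j
    exact degreeOf_eq_zero_of_isAlgebraic hπ hp0 hij.symm
  obtain ⟨δ, hδ, hS⟩ := exists_derivation_of_not_isAlgebraic _ hnot
  exact ⟨δ, hδ, hS (mem_agreeing_of_dvd_diffNumer hp hπ hp0 (hpk.trans h)),
    hS (mem_agreeing_of_dvd_diffNumer hp hπ hp0 (hpk.trans h'))⟩

/-! ### The gcd of the numerators and the main theorem -/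

theorem gPoly_ne_one_iff {N D : Fin 3 → MvPolynomial (Fin 2) K} {A : Fin 3 → K} :
    gPoly N D A ≠ 1 ↔
      0 < (polyGcd (diffNumer (chi N D A 1)) (diffNumer (chi N D A 2))).totalDegree := by
  unfold gPoly
  dsimp only
  split_ifs with h
  · refine iff_of_true (fun h1 => ?_) h
    rw [h1, totalDegree_one] at h
    exact lt_irrefl 0 h
  · exact iff_of_false (fun h1 => h1 rfl) h

theorem polyGcd_dvd_left (p q : DoubledPoly K) : polyGcd p q ∣ p :=
  (UniqueFactorizationMonoid.toGCDMonoid (DoubledPoly K)).gcd_dvd_left p q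

theorem polyGcd_dvd_right (p q : DoubledPoly K) : polyGcd p q ∣ q :=
  (UniqueFactorizationMonoid.toGCDMonoid (DoubledPoly K)).gcd_dvd_right p q

theorem dvd_polyGcd {r p q : DoubledPoly K} (hp : r ∣ p) (hq : r ∣ q) : r ∣ polyGcd p q :=
  (UniqueFactorizationMonoid.toGCDMonoid (DoubledPoly K)).dvd_gcd hp hq

/-- The hypothesis `h` rules out a zero gcd, whose `totalDegree` would be `0`. -/
theorem totalDegree_polyGcd_pos {r p q : DoubledPoly K} (hr : 0 < r.totalDegree) (hp : r ∣ p)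
    (hq : r ∣ q) (h : polyGcd p q ∣ r) : 0 < (polyGcd p q).totalDegree := by
  have hr0 : r ≠ 0 := by
    rintro rfl
    simp at hr
  obtain ⟨g, hg⟩ := dvd_polyGcd hp hq
  have hk : polyGcd p q ≠ 0 := fun h0 => hr0 (zero_dvd_iff.1 (h0 ▸ h))
  rw [hg] at hk ⊢
  rw [totalDegree_mul_of_isDomain (left_ne_zero_of_mul hk) (right_ne_zero_of_mul hk)]
  lia

theorem inTS_algebraMap (c : K) : inTS (algebraMap K (RatFun K) c) =
    inH (algebraMap K (RatFun K) c) := by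
  rw [← toRat_C, inTS_toRat, inH_toRat, map_C]

theorem diffNumer_dvd_of_affine {χ χ' : RatFun K} {α β : K}
    (h : χ' = algebraMap K (RatFun K) α + algebraMap K (RatFun K) β * χ) :
    diffNumer χ ∣ diffNumer χ' := by
  have hd : inTS χ' - inH χ' = inTS (algebraMap K (RatFun K) β) * (inTS χ - inH χ) := by
    rw [h, map_add, map_add, map_mul, map_mul, ← inTS_algebraMap, ← inTS_algebraMap]
    ring
  have hβ : inTS (algebraMap K (RatFun K) β) = algebraMap (DoubledPoly K) _ (C (C β)) := by
    rw [← toRat_C, inTS_toRat, map_C]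
  have hnd : ∀ x : FractionRing (DoubledPoly K), x * algebraMap (DoubledPoly K) _
      (IsFractionRing.den (DoubledPoly K) x : DoubledPoly K) =
        algebraMap (DoubledPoly K) _ (IsFractionRing.num (DoubledPoly K) x) := fun x => by
    have := IsFractionRing.mk'_num_den' (DoubledPoly K) x
    rw [div_eq_iff (IsFractionRing.to_map_ne_zero_of_mem_nonZeroDivisors
      (IsFractionRing.den (DoubledPoly K) _).2)] at this
    exact this.symm
  have h1 := hnd (inTS χ - inH χ)
  have h2 := hnd (inTS χ' - inH χ')
  have heq : diffNumer χ' * (IsFractionRing.den (DoubledPoly K) (inTS χ - inH χ) : DoubledPoly K) =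
      diffNumer χ * (C (C β) *
        (IsFractionRing.den (DoubledPoly K) (inTS χ' - inH χ') : DoubledPoly K)) := by
    apply IsFractionRing.injective (DoubledPoly K) (FractionRing (DoubledPoly K))
    simp only [map_mul, diffNumer, ← h1, ← h2, ← hβ]
    rw [hd]
    ring
  exact (IsFractionRing.num_den_reduced (DoubledPoly K) (inTS χ - inH χ)).dvd_of_dvd_mul_right
    (Dvd.intro _ heq.symm)

variable {N D : Fin 3 → MvPolynomial (Fin 2) K} {Z : Set (Fin 3 → K)}

/-- The image of a dominant map to a surface is not contained in a line through `A`. -/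
theorem exists_chi_ne_const [IsAlgClosed K] (hZ : IsAffineSurface Z)
    (hpar : ¬ IsCoordinateParallelPlane Z) (hQ : IsReducedParametrization N D Z) (A : Fin 3 → K) :
    ¬ ((∃ c, chi N D A 1 = algebraMap K (RatFun K) c) ∧
      ∃ c, chi N D A 2 = algebraMap K (RatFun K) c) := by
  rintro ⟨⟨c, hc⟩, d, hd⟩
  have h0 := hQ.coordFun_zero_ne hZ hpar (A 0)
  rw [chi_eq hQ.den_ne_zero, div_eq_iff h0] at hc hd
  have h1 := hQ.eq_plane hZ (u := ![-c, 1, 0]) (e := A 1 - c * A 0) (by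
    intro h; simpa using congrFun h 1) (by
      simp only [aeval_planePoly]
      simp only [Matrix.cons_val, map_neg, map_sub, map_mul, map_one, map_zero]
      linear_combination hc)
  have h2 := hQ.eq_plane hZ (u := ![-d, 0, 1]) (e := A 2 - d * A 0) (by
    intro h; simpa using congrFun h 2) (by
      simp only [aeval_planePoly]
      simp only [Matrix.cons_val, map_neg, map_sub, map_mul, map_one, map_zero]
      linear_combination hd)
  -- Moving `A` along the third axis stays on the first plane but leaves the second.
  have hmem : ![A 0, A 1, A 2 + 1] ∈ Z := by
    rw [h1, Set.mem_ofPred_eq]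
    simp only [Matrix.cons_val]
    ring
  rw [h2, Set.mem_ofPred_eq] at hmem
  simp only [Matrix.cons_val] at hmem
  exact one_ne_zero (α := K) (by linear_combination hmem)

theorem gPoly_ne_one_of_isPlane [IsAlgClosed K] (hZ : IsAffineSurface Z)
    (hpar : ¬ IsCoordinateParallelPlane Z) (hQ : IsReducedParametrization N D Z)
    (h : IsPlane Z) {A : Fin 3 → K} (hA : A ∈ Z) : gPoly N D A ≠ 1 := by
  rw [gPoly_ne_one_iff]
  obtain ⟨u, e, hu, hZe⟩ := h
  have h0 := hQ.coordFun_zero_ne hZ hpar (A 0)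
  have hX : aeval (coordFun N D) (planePoly u e) = 0 := hQ.aeval_eq_zero fun p hp => by
    rw [hZe] at hp
    rw [eval_planePoly, show _ = e from hp, sub_self]
  have hAe : u 0 * A 0 + u 1 * A 1 + u 2 * A 2 = e := by rwa [hZe] at hA
  rw [aeval_planePoly, ← hAe] at hX
  simp only [map_add, map_mul] at hX
  -- The plane equation centred at `A`, divided by `x_0 - a_0`.
  have hrel : algebraMap K (RatFun K) (u 0) + algebraMap K _ (u 1) * chi N D A 1 +
      algebraMap K _ (u 2) * chi N D A 2 = 0 := by
    rw [chi_eq hQ.den_ne_zero, chi_eq hQ.den_ne_zero]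
    field_simp
    linear_combination hX
  have key : ∀ {χ χ' : RatFun K} {a b c : K}, c ≠ 0 → algebraMap K (RatFun K) a +
      algebraMap K _ b * χ + algebraMap K _ c * χ' = 0 →
      χ' = algebraMap K (RatFun K) (-a / c) + algebraMap K (RatFun K) (-b / c) * χ := by
    intro χ χ' a b c hc h
    have hc' : algebraMap K (RatFun K) c ≠ 0 := by simpa using hc
    simp only [map_div₀, map_neg]
    field_simp
    linear_combination h
  have hne := exists_chi_ne_const hZ hpar hQ A
  have hconst : ∀ {χ χ' : RatFun K} {a b : K}, χ' = algebraMap K (RatFun K) a +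
      algebraMap K (RatFun K) b * χ → (∃ c, χ = algebraMap K (RatFun K) c) →
      ∃ c, χ' = algebraMap K (RatFun K) c := by
    rintro χ χ' a b h ⟨c, rfl⟩
    exact ⟨a + b * c, by rw [h]; simp⟩
  by_cases h2 : u 2 = 0
  · by_cases h1 : u 1 = 0
    · exfalso
      have hu0 : u 0 ≠ 0 := fun hu0 => hu (by ext i; fin_cases i <;> assumption)
      refine hpar ⟨0, e / u 0, ?_⟩
      rw [hZe]
      ext p
      simp [h1, h2, eq_div_iff hu0, mul_comm]
    · have hχ := key (χ := chi N D A 2) (χ' := chi N D A 1) (a := u 0)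
        (b := u 2) h1 (by rw [← hrel]; ring)
      refine totalDegree_polyGcd_pos (totalDegree_diffNumer_pos fun c hc => hne
        ⟨hconst hχ ⟨c, hc⟩, c, hc⟩) (diffNumer_dvd_of_affine hχ) dvd_rfl (polyGcd_dvd_right _ _)
  · have hχ := key (χ := chi N D A 1) h2 hrel
    exact totalDegree_polyGcd_pos (totalDegree_diffNumer_pos fun c hc => hne
      ⟨⟨c, hc⟩, hconst hχ ⟨c, hc⟩⟩) dvd_rfl (diffNumer_dvd_of_affine hχ) (polyGcd_dvd_left _ _)

/-- If the projection from `A` is degenerate, then some derivation of the function field moves the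
generic point of the surface in the direction of `A`. -/
theorem exists_derivation_eq_of_gPoly_ne_one [IsAlgClosed K] [CharZero K] (hZ : IsAffineSurface Z)
    (hpar : ¬ IsCoordinateParallelPlane Z) (hQ : IsReducedParametrization N D Z)
    {A : Fin 3 → K} (h : gPoly N D A ≠ 1) :
    ∃ δ : Derivation K (RatFun K) (RatFun K), ∀ i,
      δ (coordFun N D i) = coordFun N D i - algebraMap K (RatFun K) (A i) := by
  obtain ⟨δ, hδ, h1, h2⟩ := exists_derivation_of_common_factor (gPoly_ne_one_iff.1 h)
    (polyGcd_dvd_left _ _) (polyGcd_dvd_right _ _)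
  have h0 := hQ.coordFun_zero_ne hZ hpar (A 0)
  set x := coordFun N D with hx
  have hj : ∀ j, δ (chi N D A j) = 0 → δ (x j) =
      (δ (x 0) / (x 0 - algebraMap K (RatFun K) (A 0))) *
        (x j - algebraMap K (RatFun K) (A j)) := by
    intro j hj
    have h3 : x j - algebraMap K (RatFun K) (A j) =
        chi N D A j * (x 0 - algebraMap K (RatFun K) (A 0)) := by
      rw [chi_eq hQ.den_ne_zero, div_mul_cancel₀ _ h0]
    have h4 := congrArg δ h3
    rw [Derivation.leibniz, hj, map_sub, map_sub, Derivation.map_algebraMap,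
      Derivation.map_algebraMap, sub_zero, sub_zero, smul_zero, add_zero, smul_eq_mul] at h4
    rw [h4, h3]
    field_simp
  have hall : ∀ j, δ (x j) = (δ (x 0) / (x 0 - algebraMap K (RatFun K) (A 0))) *
      (x j - algebraMap K (RatFun K) (A j)) := by
    intro j
    fin_cases j
    · exact (div_mul_cancel₀ _ h0).symm
    · exact hj 1 h1
    · exact hj 2 h2
  set c := δ (x 0) / (x 0 - algebraMap K (RatFun K) (A 0))
  have hc : c ≠ 0 := by
    intro hc
    obtain ⟨i, hi⟩ := hQ.exists_derivation_ne_zero hZ hδ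
    exact hi (by rw [← hx, hall i, hc, zero_mul])
  refine ⟨c⁻¹ • δ, fun i => ?_⟩
  rw [Derivation.smul_apply, hall i, smul_eq_mul, inv_mul_cancel_left₀ hc]

theorem isPlane_of_gPoly_ne_one [IsAlgClosed K] [CharZero K] (hZ : IsAffineSurface Z)
    (hpar : ¬ IsCoordinateParallelPlane Z) (hQ : IsReducedParametrization N D Z)
    {Ω : Set (Fin 3 → K)} (hΩ : IsDenseSubset Ω Z) (h : ∀ A ∈ Ω, gPoly N D A ≠ 1) :
    IsPlane Z := by
  obtain ⟨V, hV, hmem⟩ := finrank_derivation_image_le (coordFun N D)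
  have hVtop : V < ⊤ := by
    refine lt_top_iff_ne_top.2 fun hV' => ?_
    rw [hV', finrank_top, Module.finrank_fin_fun] at hV
    lia
  obtain ⟨n, hn, hVn⟩ := Submodule.exists_le_ker_of_lt_top V hVtop
  obtain ⟨i, hi⟩ : ∃ i, n (Pi.single i 1) ≠ 0 := by
    by_contra! hc
    exact hn (LinearMap.pi_ext' fun i => LinearMap.ext_ring (hc i))
  -- The coefficients of `n` lie in `L`; `ℓ` brings them down to `K` while keeping one of them
  -- nonzero.
  obtain ⟨ℓ, hℓ⟩ : ∃ ℓ : RatFun K →ₗ[K] K, ℓ (n (Pi.single i 1)) ≠ 0 := by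
    by_contra! hc
    exact hi ((Module.forall_dual_apply_eq_zero_iff K _).1 hc)
  let u : Fin 3 → K := fun i => ℓ (n (Pi.single i 1))
  let e : K := ℓ (n (coordFun N D))
  have hu : u ≠ 0 := fun h0 => hℓ (congrFun h0 i)
  have hA : ∀ A ∈ Ω, u 0 * A 0 + u 1 * A 1 + u 2 * A 2 = e := by
    intro A hA
    obtain ⟨δ, hδ⟩ := exists_derivation_eq_of_gPoly_ne_one hZ hpar hQ (h A hA)
    -- The vector `x - A` equals `δ x`, so it lies in `V`, which `n` kills.
    have h1 : n (coordFun N D - fun i => algebraMap K (RatFun K) (A i)) = 0 := by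
      apply hVn
      convert hmem δ using 1
      ext i
      exact (hδ i).symm
    rw [map_sub, sub_eq_zero] at h1
    have h2 : (fun i => algebraMap K (RatFun K) (A i)) =
        ∑ i, A i • (Pi.single i 1 : Fin 3 → RatFun K) := by
      ext j
      simp [Finset.sum_apply, Pi.single_apply, Algebra.smul_def]
    have h3 : e = ∑ i, A i * u i := by
      simp only [e, u]
      rw [h1, h2, map_sum, map_sum]
      refine Finset.sum_congr rfl fun i _ => ?_
      rw [LinearMap.map_smul_of_tower, map_smul, smul_eq_mul]
    rw [h3, Fin.sum_univ_three]
    ring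
  refine ⟨u, e, hu, hZ.eq_plane_of_subset hu fun p hp => ?_⟩
  have := hΩ.2 hp (planePoly u e) (fun A hAΩ => by
    rw [aeval_eq_eval]
    exact (eval_planePoly u e A).trans (sub_eq_zero.2 (hA A hAΩ)))
  rw [aeval_eq_eval] at this
  exact sub_eq_zero.1 ((eval_planePoly u e p).symm.trans this)

theorem IsReducedParametrization.nonempty [Infinite K] (hQ : IsReducedParametrization N D Z) :
    Z.Nonempty := by
  have hD : ∏ i, D i ≠ 0 := Finset.prod_ne_zero_iff.2 fun i _ => hQ.den_ne_zero i
  obtain ⟨τ, hτ⟩ : ∃ τ, eval τ (∏ i, D i) ≠ 0 := by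
    by_contra! hc
    exact hD (MvPolynomial.funext fun τ => by rw [hc, map_zero])
  rw [map_prod, Finset.prod_ne_zero_iff] at hτ
  exact ⟨_, hQ.dense.1 ⟨τ, fun i => hτ i (Finset.mem_univ i), fun _ => rfl⟩⟩

theorem isDenseSubset_refl {σ : Type*} (Z : Set (σ → K)) : IsDenseSubset Z Z :=
  ⟨subset_rfl, zeroLocus_vanishingIdeal_le Z⟩

end RationalSurface

theorem mainTheorem6 {K : Type*} [Field K] [IsAlgClosed K] [CharZero K]
    (Z : Set (Fin 3 → K)) (hZ : RationalSurface.IsAffineSurface Z)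
    (hpar : ¬ RationalSurface.IsCoordinateParallelPlane Z)
    (N D : Fin 3 → MvPolynomial (Fin 2) K)
    (hQ : RationalSurface.IsReducedParametrization N D Z) :
    RationalSurface.IsPlane Z ↔
      ∃ Ω : Set (Fin 3 → K), Ω.Nonempty ∧ RationalSurface.IsDenseSubset Ω Z ∧
        ∀ A ∈ Ω, RationalSurface.gPoly N D A ≠ 1 := by
  refine ⟨fun h => ⟨Z, hQ.nonempty, RationalSurface.isDenseSubset_refl Z, fun A hA =>
    RationalSurface.gPoly_ne_one_of_isPlane hZ hpar hQ h hA⟩, ?_⟩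
  rintro ⟨Ω, -, hΩ, h⟩
  exact RationalSurface.isPlane_of_gPoly_ne_one hZ hpar hQ hΩ h
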